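/- Let $2^\omega$ be the space of infinite binary sequences with the metric $d(x,y)=2^{-n}$, where $n$ is least with $x(n)\neq y(n)$ (and $d(x,x)=0$). Let $\le_Q$ be a locally countable Borel quasi-order on $2^\omega$, that is, a reflexive and transitive relation which is a Borel subset of $2^\omega\times 2^\omega$ and such that $\{x : x\le_Q y\}$ is countable for every $y\in 2^\omega$. Let $g:[0,\infty)\to[0,\infty)$ be a gauge function, that is, a (weakly) increasing, right-continuous function with $g(0)=0$ and $g(t)>0$ for $t>0$, and suppose that $g\prec\mathrm{id}$, i.e. $\lim_{t\to0^+} t/g(t)=0$ (equivalently, $g(t)/t\to\infty$ as $t\to 0^+$). Then there is a closed set $B\subseteq 2^\omega$ with $H^g(B)>0$ that is a $\le_Q$-antichain, i.e. $x\not\le_Q y$ for all distinct $x,y\in B$. Here $H^g(B)=\lim_{\delta\to0^+}H^g_\delta(B)\in[0,\infty]$, where $$H^g_\delta(B)=\inf\Big\{\sum_{i=0}^\infty g(\operatorname{diam} U_i) : (U_i)_{i\in\omega}\text{ is a cover of } B \text{ by open sets of diameter}<\delta\Big\}.$$ -/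

import Mathlib

open Filter Topology
open scoped NNReal ENNReal MeasureTheory

/-- The Cantor space `2^ω` of infinite binary sequences carries the metric with
`d(x, y) = 2^(-n)`, where `n` is least such that `x n ≠ y n`, and `d(x, x) = 0`
(see `cantor_dist_eq`). Its topology is the product topology. -/
noncomputable instance cantorMetricSpace : MetricSpace (ℕ → Bool) :=
  PiNat.metricSpace

theorem cantor_dist_eq {x y : ℕ → Bool} {n : ℕ} (hn : x n ≠ y n) (hlt : ∀ m < n, x m = y m) :
    dist x y = 2⁻¹ ^ n := by
  have hne : x ≠ y := fun h => hn (congrFun h n)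
  have hf : PiNat.firstDiff x y = n := by
    apply le_antisymm
    · by_contra! h
      exact hn (PiNat.apply_eq_of_lt_firstDiff h)
    · by_contra! h
      exact PiNat.apply_firstDiff_ne hne (hlt _ h)
  have h := PiNat.dist_eq_of_ne (E := fun _ => Bool) hne
  rw [hf, one_div] at h
  exact h

/-- A gauge function `g : [0, ∞) → [0, ∞)`: increasing (in the weak sense), continuous on the
right, zero at `0` and positive on `(0, ∞)`. -/
structure IsGauge (g : ℝ≥0 → ℝ≥0) : Prop where
  monotone : Monotone g
  right_continuous : ∀ t, ContinuousWithinAt g (Set.Ici t) t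
  map_zero : g 0 = 0
  pos : ∀ t, 0 < t → 0 < g t

/-- `f ≺ g`, i.e. `g` has higher order than `f`: `g(t) / f(t) → 0` as `t → 0⁺`. -/
def GaugePrec (f g : ℝ≥0 → ℝ≥0) : Prop :=
  Tendsto (fun t => g t / f t) (𝓝[>] 0) (𝓝 0)

/-- `H^g_δ(A)`: the infimum of `∑ g(diam U_i)` over the countable covers of `A` by
open sets `U_i` of diameter less than `δ`. -/
noncomputable def gaugePremeasure {X : Type*} [MetricSpace X] (g : ℝ≥0 → ℝ≥0) (δ : ℝ≥0)
    (A : Set X) : ℝ≥0∞ :=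
  ⨅ (U : ℕ → Set X) (_ : ∀ i, IsOpen (U i)) (_ : ∀ i, Metric.ediam (U i) < δ)
    (_ : A ⊆ ⋃ i, U i), ∑' i, (g (Metric.ediam (U i)).toNNReal : ℝ≥0∞)

/-- The gauge measure `H^g(A)`, the limit of `H^g_δ(A)` as `δ → 0⁺`. Since `H^g_δ(A)` increases
as `δ` decreases, this is the supremum over `δ > 0` (see `tendsto_gaugePremeasure`). -/
noncomputable def gaugeMeasure {X : Type*} [MetricSpace X] (g : ℝ≥0 → ℝ≥0) (A : Set X) : ℝ≥0∞ :=
  ⨆ (δ : ℝ≥0) (_ : 0 < δ), gaugePremeasure g δ A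

theorem tendsto_gaugePremeasure {X : Type*} [MetricSpace X] (g : ℝ≥0 → ℝ≥0) (A : Set X) :
    Tendsto (fun δ => gaugePremeasure g δ A) (𝓝[>] 0) (𝓝 (gaugeMeasure g A)) := by
  have h : Antitone (fun δ : ℝ≥0 => gaugePremeasure g δ A) := by
    intro a b hab
    refine le_iInf fun U => le_iInf fun ho => le_iInf fun hd => le_iInf fun hc => ?_
    exact iInf_le_of_le U (iInf_le_of_le ho (iInf_le_of_le
      (fun i => (hd i).trans_le (by exact_mod_cast hab)) (iInf_le_of_le hc le_rfl)))
  have h2 := h.tendsto_nhdsGT 0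
  rw [sSup_image] at h2
  exact h2

/-- `Q x y` reads `x ≤_Q y`. A locally countable Borel quasi-order on a topological space `X`: a
reflexive and transitive relation that is a Borel subset of `X × X` and for which every
`{x | x ≤_Q y}` is countable. -/
structure IsLocallyCountableBorelQuasiOrder {X : Type*} [TopologicalSpace X]
    (Q : X → X → Prop) : Prop where
  refl : ∀ x, Q x x
  trans : ∀ x y z, Q x y → Q y z → Q x z
  borel : MeasurableSet[borel (X × X)] {p : X × X | Q p.1 p.2}
  locally_countable : ∀ y, {x | Q x y}.Countable

/-! For almost every `y` in the fair coin measure, the countable set `{x | x ≤_Q y}` is listed by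
countably many measurable functions `f i` (`exists_measurable_forall_ae_exists_eq`). So it suffices
to find a large closed `B` inside this full-measure set with `f i y ≠ x` for distinct `x, y ∈ B`.
This splits into countably many requirements `(i, n, b)`: no `x` with `n`-th bit `b` is `f i y` for
a `y` with the opposite bit.

A fusion meets them one by one along decreasing closed sets `C s` carrying probability measures `m
s`. For one requirement, a set `S` roughly halves the measure and its image under `f i` on all
cylinders of length `L` at once (`exists_almost_halving`). On one side the points of `S` are kept,
on the other the points sent outside `S`. Rescaling restores the mass of every cylinder of length at
most `L` and costs a factor 4 on longer ones. Since `t / g t → 0`, a large `L` lets `g` absorb this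
factor, and `m s` stays below `g` on cylinders.

An open cover of `⋂ s, C s` already covers some `C s`, so the mass distribution principle for `m s`
bounds its sum below by 1. -/

namespace MeasureTheory

/-! ### Inner regularity and null-measurability of analytic sets -/

/-- The points of Baire space which are bounded by `b` below `k`. -/
def baireBox (b : ℕ → ℕ) (k : ℕ) : Set (ℕ → ℕ) := {z | ∀ i < k, z i ≤ b i}

/-- Relaxing the bound on coordinate `k` exhausts the box, and a measure is continuous along
increasing unions even of non-measurable sets. -/
theorem exists_measure_image_baireBox_succ {α : Type*} [MeasurableSpace α] {μ : Measure α}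
    (φ : (ℕ → ℕ) → α) {r : ℝ≥0∞} {b : ℕ → ℕ} {k : ℕ} (h : r < μ (φ '' baireBox b k)) :
    ∃ v, r < μ (φ '' baireBox (Function.update b k v) (k + 1)) := by
  have hmono : Monotone fun v => φ '' baireBox (Function.update b k v) (k + 1) := by
    refine fun v w hvw => Set.image_mono fun z hz i hi => (hz i hi).trans ?_
    rcases eq_or_ne i k with rfl | hik
    · simpa using hvw
    · simp [hik]
  have hU : φ '' baireBox b k = ⋃ v, φ '' baireBox (Function.update b k v) (k + 1) := by
    rw [← Set.image_iUnion]
    congr 1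
    ext z
    simp only [Set.mem_iUnion]
    constructor
    · refine fun hz => ⟨z k, fun i hi => ?_⟩
      rcases eq_or_ne i k with rfl | hik
      · simp
      · simpa [hik] using hz i (by omega)
    · rintro ⟨v, hv⟩ i hi
      simpa [hi.ne] using hv i (by omega)
  rw [hU, hmono.measure_iUnion] at h
  exact lt_iSup_iff.1 h

theorem exists_forall_lt_measure_image_baireBox {α : Type*} [MeasurableSpace α] {μ : Measure α}
    (φ : (ℕ → ℕ) → α) {r : ℝ≥0∞} (h : r < μ (Set.range φ)) :
    ∃ b : ℕ → ℕ, ∀ k, r < μ (φ '' baireBox b k) := by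
  choose v hv using fun (b : ℕ → ℕ) (k : ℕ) (h : r < μ (φ '' baireBox b k)) =>
    exists_measure_image_baireBox_succ φ h
  let c : ∀ k : ℕ, {b : ℕ → ℕ // r < μ (φ '' baireBox b k)} := fun k =>
    Nat.rec ⟨0, by
      have : baireBox 0 0 = Set.univ := by ext; simp [baireBox]
      rwa [this, Set.image_univ]⟩
      (fun k b => ⟨Function.update b.1 k (v b.1 k b.2), hv b.1 k b.2⟩) k
  have hc : ∀ k, (c (k + 1)).1 = Function.update (c k).1 k (v (c k).1 k (c k).2) := fun k => rfl
  have hstab : ∀ k, ∀ i < k, (c k).1 i = (c (i + 1)).1 i := by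
    intro k
    induction k with
    | zero => intro i hi; omega
    | succ k ih =>
      intro i hi
      rcases eq_or_ne i k with rfl | hik
      · rfl
      · rw [hc, Function.update_of_ne hik]
        exact ih i (by omega)
  refine ⟨fun i => (c (i + 1)).1 i, fun k => ?_⟩
  have : baireBox (fun i => (c (i + 1)).1 i) k = baireBox (c k).1 k := by
    ext z
    exact forall₂_congr fun i hi => by rw [hstab k i hi]
  rw [this]
  exact (c k).2

/-- An analytic set can be approximated from inside by compact sets. -/
theorem AnalyticSet.exists_isCompact_le_measure {α : Type*} [TopologicalSpace α]
    [MeasurableSpace α] {μ : Measure α} [μ.OuterRegular] {s : Set α} (hs : AnalyticSet s)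
    {r : ℝ≥0∞} (hr : r < μ s) : ∃ K ⊆ s, IsCompact K ∧ r ≤ μ K := by
  rw [AnalyticSet] at hs
  rcases hs with rfl | ⟨φ, hφ, rfl⟩
  · simp at hr
  obtain ⟨b, hb⟩ := exists_forall_lt_measure_image_baireBox φ hr
  have hcomp : IsCompact (Set.univ.pi fun i => Set.Iic (b i)) :=
    isCompact_univ_pi fun i => (Set.finite_Iic (b i)).isCompact
  refine ⟨φ '' (Set.univ.pi fun i => Set.Iic (b i)), Set.image_subset_range _ _,
    hcomp.image hφ, ?_⟩
  by_contra! hlt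
  obtain ⟨U, hKU, hU, hUr⟩ := Set.exists_isOpen_lt_of_lt _ _ hlt
  have hex : ∀ k, ∃ z ∈ baireBox b k, φ z ∉ U := by
    intro k
    by_contra! h
    exact ((hb k).trans_le (measure_mono (Set.image_subset_iff.2 h))).not_gt hUr
  choose z hz hzU using hex
  -- Truncating `z k` by `b` puts it in the compact box and changes no coordinate below `k`, so the
  -- `z (ψ k)` have the same limit.
  obtain ⟨w, hw, ψ, hψ, hlim⟩ := hcomp.tendsto_subseq (x := fun k i => min (z k i) (b i))
    fun k i _ => Set.mem_Iic.2 (min_le_right _ _)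
  have hlim' : Tendsto (z ∘ ψ) atTop (𝓝 w) := by
    rw [tendsto_pi_nhds] at hlim ⊢
    intro i
    refine (hlim i).congr' ?_
    filter_upwards [eventually_gt_atTop i] with k hk
    exact min_eq_left (hz _ i (hk.trans_le hψ.le_apply))
  have hwU : φ w ∈ U := hKU (Set.mem_image_of_mem _ hw)
  have := (hφ.tendsto w).comp hlim' |>.eventually (hU.mem_nhds hwU)
  obtain ⟨k, hk⟩ := this.exists
  exact hzU _ hk

/-- Analytic sets are measurable with respect to the completion of every finite measure. -/
theorem AnalyticSet.nullMeasurableSet {α : Type*} [TopologicalSpace α] [T2Space α]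
    [MeasurableSpace α] [OpensMeasurableSpace α] {μ : Measure α} [μ.OuterRegular]
    [IsFiniteMeasure μ] {s : Set α} (hs : AnalyticSet s) : NullMeasurableSet s μ := by
  rcases eq_or_ne (μ s) 0 with h0 | h0
  · exact NullMeasurableSet.of_null h0
  obtain ⟨r, -, hr, hlim⟩ := exists_seq_strictMono_tendsto' (pos_iff_ne_zero.2 h0)
  choose K hKs hK hrK using fun n => hs.exists_isCompact_le_measure (hr n).2
  have hm : MeasurableSet (⋃ n, K n) := .iUnion fun n => (hK n).measurableSet
  have hle : μ s ≤ μ (⋃ n, K n) :=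
    le_of_tendsto' hlim fun n => (hrK n).trans (measure_mono (Set.subset_iUnion K n))
  exact hm.nullMeasurableSet.congr (ae_eq_of_subset_of_measure_ge (Set.iUnion_subset hKs) hle
    hm.nullMeasurableSet (measure_ne_top _ _))

end MeasureTheory

/-! ### Lusin–Novikov up to a null set -/

namespace MeasureTheory

/-- Up to a null set of fibres of `π`, the set `G` is covered by countably many measurable sets
on which `π` is injective. -/
def IsThin {Z Y : Type*} [MeasurableSpace Z] [MeasurableSpace Y] (π : Z → Y) (μ : Measure Y)
    (G : Set Z) : Prop :=
  ∃ S : ℕ → Set Z, (∀ i, MeasurableSet (S i)) ∧ (∀ i, Set.InjOn π (S i)) ∧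
    ∃ N, μ N = 0 ∧ G ⊆ π ⁻¹' N ∪ ⋃ i, S i

section Thin

variable {Z Y : Type*} [MeasurableSpace Z] [MeasurableSpace Y] {π : Z → Y} {μ : Measure Y}

theorem IsThin.mono {G H : Set Z} (hH : IsThin π μ H) (h : G ⊆ H) : IsThin π μ G := by
  obtain ⟨S, hS, hinj, N, hN, hc⟩ := hH
  exact ⟨S, hS, hinj, N, hN, h.trans hc⟩

theorem IsThin.of_injOn {G : Set Z} (hG : MeasurableSet G) (h : Set.InjOn π G) : IsThin π μ G :=
  ⟨fun _ => G, fun _ => hG, fun _ => h, ∅, measure_empty, fun z hz => by simp [hz]⟩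

theorem IsThin.preimage_null {N : Set Y} (hN : μ N = 0) : IsThin π μ (π ⁻¹' N) :=
  ⟨fun _ => ∅, fun _ => .empty, fun _ => Set.injOn_empty π, N, hN, by simp⟩

theorem IsThin.iUnion {ι : Type*} [Countable ι] {G : ι → Set Z} (h : ∀ i, IsThin π μ (G i)) :
    IsThin π μ (⋃ i, G i) := by
  rcases isEmpty_or_nonempty ι with hι | hι
  · simpa using IsThin.of_injOn (π := π) (μ := μ) MeasurableSet.empty (Set.injOn_empty π)
  choose S hS hinj N hN hc using h
  obtain ⟨e, he⟩ := exists_surjective_nat (ι × ℕ)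
  refine ⟨fun n => S (e n).1 (e n).2, fun n => hS _ _, fun n => hinj _ _, ⋃ i, N i,
    measure_iUnion_null hN, Set.iUnion_subset fun i z hz => ?_⟩
  rcases hc i hz with h | h
  · exact Or.inl (Set.mem_iUnion.2 ⟨i, h⟩)
  · obtain ⟨j, hj⟩ := Set.mem_iUnion.1 h
    obtain ⟨n, hn⟩ := he (i, j)
    exact Or.inr (Set.mem_iUnion.2 ⟨n, by simpa [hn] using hj⟩)

theorem IsThin.union {G H : Set Z} (hG : IsThin π μ G) (hH : IsThin π μ H) :
    IsThin π μ (G ∪ H) := by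
  rw [Set.union_eq_iUnion]
  exact .iUnion fun b => by cases b <;> assumption

/-- Exhaustion: a class of measurable sets closed under countable unions has a member which
is largest up to null sets. -/
theorem exists_measurableSet_maximal (μ : Measure Y) [IsFiniteMeasure μ] (p : Set Y → Prop)
    (h0 : p ∅) (hp : ∀ s : ℕ → Set Y, (∀ i, p (s i)) → p (⋃ i, s i)) :
    ∃ W, MeasurableSet W ∧ p W ∧ ∀ V, MeasurableSet V → p V → μ (V \ W) = 0 := by
  let T : Set ℝ≥0∞ := μ '' {V | MeasurableSet V ∧ p V}
  have hT : T.Nonempty := ⟨_, ∅, ⟨.empty, h0⟩, rfl⟩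
  obtain ⟨u, -, hu, huT⟩ := exists_seq_tendsto_sSup hT (OrderTop.bddAbove T)
  choose V hV hVu using huT
  have hW : MeasurableSet (⋃ i, V i) := .iUnion fun i => (hV i).1
  have hpW : p (⋃ i, V i) := hp V fun i => (hV i).2
  refine ⟨⋃ i, V i, hW, hpW, fun A hA hpA => ?_⟩
  have hsup : sSup T ≤ μ (⋃ i, V i) :=
    le_of_tendsto' hu fun i => (hVu i).symm.le.trans (measure_mono (Set.subset_iUnion V i))
  have hpu : p (A ∪ ⋃ i, V i) := by
    have := hp (fun i => Nat.casesOn i A fun _ => ⋃ i, V i) (fun i => by cases i <;> assumption)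
    convert this using 1
    ext y
    simp only [Set.mem_union]
    rw [Set.mem_iUnion (s := fun i : ℕ => (Nat.casesOn i A fun _ => ⋃ i, V i : Set Y))]
    constructor
    · rintro (h | h)
      · exact ⟨0, h⟩
      · exact ⟨1, h⟩
    · rintro ⟨_ | i, h⟩
      · exact Or.inl h
      · exact Or.inr h
  have hle : μ (A ∪ ⋃ i, V i) ≤ μ (⋃ i, V i) :=
    (le_sSup (show μ (A ∪ ⋃ i, V i) ∈ T from ⟨_, ⟨hA.union hW, hpu⟩, rfl⟩)).trans hsup
  rw [← Set.sdiff_union_self, measure_union Set.disjoint_sdiff_left hW, add_comm] at hle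
  by_contra hne
  exact (ENNReal.lt_add_right (measure_ne_top μ _) hne).not_ge hle

end Thin

/-- A closed countable set in a Polish space in which no basic open set isolates a point
is empty. -/
theorem eq_empty_of_countable_of_forall_not_isolated {Z : Type*} [TopologicalSpace Z]
    [PolishSpace Z] {b : Set (Set Z)} (hb : TopologicalSpace.IsTopologicalBasis b) {C : Set Z}
    (hC : IsClosed C) (hcount : C.Countable)
    (h : ∀ U ∈ b, ∀ z ∈ C ∩ U, ∃ w ∈ C ∩ U, w ≠ z) : C = ∅ := by
  by_contra hne
  let := TopologicalSpace.upgradeIsCompletelyMetrizable Z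
  have hperf : Perfect C := by
    refine ⟨hC, fun z hz => ?_⟩
    rw [accPt_iff_nhds]
    intro V hV
    obtain ⟨U, hU, hzU, hUV⟩ := hb.mem_nhds_iff.1 hV
    obtain ⟨w, hw, hwz⟩ := h U hU z ⟨hz, hzU⟩
    exact ⟨w, ⟨hUV hw.2, hw.1⟩, hwz⟩
  obtain ⟨f, hf, -, hinj⟩ := hperf.exists_nat_bool_injection (Set.nonempty_iff_ne_empty.2 hne)
  have : Countable (ℕ → Bool) := by
    have := (hcount.mono hf).to_subtype
    exact (Set.rangeFactorization_injective.2 hinj).countable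
  obtain ⟨e, he⟩ := exists_surjective_nat (ℕ → Bool)
  obtain ⟨n, hn⟩ := he fun n => !e n n
  simpa using congrFun hn n

/-- A measure-theoretic form of the Lusin-Novikov theorem, for continuous maps. -/
theorem isThin_univ_of_continuous {Z Y : Type*} [TopologicalSpace Z] [PolishSpace Z]
    [MeasurableSpace Z] [BorelSpace Z] [TopologicalSpace Y] [T2Space Y]
    [SecondCountableTopology Y] [MeasurableSpace Y] [BorelSpace Y]
    {μ : Measure Y} [IsFiniteMeasure μ] [μ.OuterRegular] {π : Z → Y} (hπ : Continuous π)
    (hcount : ∀ y, (π ⁻¹' {y}).Countable) : IsThin π μ Set.univ := by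
  let b := TopologicalSpace.countableBasis Z
  have hb := TopologicalSpace.isBasis_countableBasis Z
  have hbc : Countable b := (TopologicalSpace.countable_countableBasis Z).to_subtype
  -- `W U` is, up to null sets, the largest set over which `U` is thin; `Z'` below is what no `U`
  -- accounts for.
  have hex := fun U : b => exists_measurableSet_maximal μ (fun V => IsThin π μ (U ∩ π ⁻¹' V))
    ((IsThin.preimage_null measure_empty).mono Set.inter_subset_right) (fun s hs => by
      rw [Set.preimage_iUnion, Set.inter_iUnion]
      exact .iUnion hs)
  choose W hW hthin hmax using hex
  have hopen : ∀ U : b, IsOpen (U : Set Z) := fun U => hb.isOpen U.2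
  have hRthin : IsThin π μ (⋃ U : b, (U : Set Z) ∩ π ⁻¹' W U) := .iUnion hthin
  set Z' : Set Z := (⋃ U : b, (U : Set Z) ∩ π ⁻¹' W U)ᶜ with hZ'
  have hZ'm : MeasurableSet Z' :=
    (MeasurableSet.iUnion fun U => (hopen U).measurableSet.inter (hπ.measurable (hW U))).compl
  -- `A U` collects the points with at least two preimages in `Z' ∩ U`. It is a projection of a
  -- Borel set, hence analytic.
  let A : b → Set Y := fun U => {y | ∃ z ∈ Z' ∩ U, ∃ w ∈ Z' ∩ U, z ≠ w ∧ π z = y ∧ π w = y}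
  have hA : ∀ U, NullMeasurableSet (A U) μ := by
    intro U
    have hS : MeasurableSet {p : Z × Z | (p.1 ∈ Z' ∩ U ∧ p.2 ∈ Z' ∩ U) ∧ p.1 ≠ p.2 ∧
        π p.1 = π p.2} := by
      have hm := hZ'm.inter (hopen U).measurableSet
      refine ((measurable_fst hm).inter (measurable_snd hm)).inter (.inter ?_ ?_)
      · exact (isOpen_ne_fun continuous_fst continuous_snd).measurableSet
      · exact (isClosed_eq (hπ.comp continuous_fst) (hπ.comp continuous_snd)).measurableSet
    have := (hS.analyticSet_image (f := fun p : Z × Z => π p.1)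
      (hπ.measurable.comp measurable_fst)).nullMeasurableSet (μ := μ)
    convert this using 1
    ext y
    constructor
    · rintro ⟨z, hz, w, hw, hne, rfl, h⟩
      exact ⟨(z, w), ⟨⟨hz, hw⟩, hne, h.symm⟩, rfl⟩
    · rintro ⟨⟨z, w⟩, ⟨⟨hz, hw⟩, hne, h⟩, rfl⟩
      exact ⟨z, hz, w, hw, hne, rfl, h.symm⟩
  -- Off `W U` and `A U`, the map is injective on `Z' ∩ U`, so maximality of `W U` leaves only a
  -- null set.
  have hnull : ∀ U, μ ((W U)ᶜ \ A U) = 0 := by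
    intro U
    obtain ⟨V, hVs, hV, hVae⟩ :=
      ((hW U).compl.nullMeasurableSet.diff (hA U)).exists_measurable_subset_ae_eq
    rw [← measure_congr hVae]
    have hinj : Set.InjOn π (Z' ∩ U ∩ π ⁻¹' V) := by
      intro z hz w hw hzw
      by_contra hne
      exact (hVs hz.2).2 ⟨z, hz.1, w, hw.1, hne, rfl, hzw.symm⟩
    have hVthin : IsThin π μ (U ∩ π ⁻¹' V) := by
      refine (hRthin.union (.of_injOn ((hZ'm.inter (hopen U).measurableSet).inter
        (hπ.measurable hV)) hinj)).mono fun z hz => ?_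
      by_cases h : z ∈ Z'
      · exact Or.inr ⟨⟨h, hz.1⟩, hz.2⟩
      · exact Or.inl (not_not.1 h)
    have h0 := hmax U V hV hVthin
    rwa [(Set.disjoint_left.2 fun y hy => (hVs hy).1 : Disjoint V (W U)).sdiff_eq_left] at h0
  refine (hRthin.union (.preimage_null (measure_iUnion_null hnull))).mono fun z _ => ?_
  by_contra! hz
  rw [Set.mem_union, not_or] at hz
  obtain ⟨hzZ, hzN⟩ := hz
  -- Over a fixed point, removing `U ∩ π ⁻¹' W U` removes all of `U` or nothing, so the fibre of
  -- `Z'` is closed. Outside the null set it has no isolated point, and being countable it is empty.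
  have hempty : Z' ∩ π ⁻¹' {π z} = ∅ := by
    refine eq_empty_of_countable_of_forall_not_isolated hb ?_
      ((hcount (π z)).mono Set.inter_subset_right) ?_
    · have : Z' ∩ π ⁻¹' {π z} =
          (⋃ U ∈ {U : b | π z ∈ W U}, (U : Set Z))ᶜ ∩ π ⁻¹' {π z} := by
        ext w
        simp only [hZ', Set.mem_inter_iff, Set.mem_compl_iff, Set.mem_iUnion, Set.mem_preimage,
          Set.mem_singleton_iff, not_exists, Set.mem_ofPred_eq]
        constructor
        · rintro ⟨h, hw⟩
          exact ⟨fun U hU hwU => h U ⟨hwU, hw ▸ hU⟩, hw⟩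
        · rintro ⟨h, hw⟩
          exact ⟨fun U hU => h U (hw ▸ hU.2) hU.1, hw⟩
      rw [this]
      exact (isOpen_biUnion fun U _ => hopen U).isClosed_compl.inter
        (isClosed_singleton.preimage hπ)
    · rintro U hU w ⟨⟨hwZ, hwz⟩, hwU⟩
      have hwW : π z ∉ W ⟨U, hU⟩ := fun h => hwZ (Set.mem_iUnion.2 ⟨⟨U, hU⟩, hwU, by
        rw [Set.mem_preimage, hwz]; exact h⟩)
      have hzA : π z ∈ A ⟨U, hU⟩ := by
        by_contra h
        exact hzN (Set.mem_iUnion.2 ⟨⟨U, hU⟩, hwW, h⟩)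
      obtain ⟨u, hu, v, hv, huv, huz, hvz⟩ := hzA
      rcases eq_or_ne u w with rfl | h
      · exact ⟨v, ⟨⟨hv.1, hvz⟩, hv.2⟩, huv.symm⟩
      · exact ⟨u, ⟨⟨hu.1, huz⟩, hu.2⟩, h⟩
  exact hempty.subset (show z ∈ Z' ∩ π ⁻¹' {π z} from ⟨hzZ, rfl⟩)

/-- A measurable countable-to-one map between standard Borel spaces is injective on each of
countably many measurable sets which cover almost all fibres. -/
theorem isThin_univ {Z Y : Type*} [MeasurableSpace Z] [StandardBorelSpace Z]
    [TopologicalSpace Y] [T2Space Y] [SecondCountableTopology Y] [MeasurableSpace Y]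
    [BorelSpace Y] {μ : Measure Y} [IsFiniteMeasure μ] [μ.OuterRegular] {π : Z → Y}
    (hπ : Measurable π) (hcount : ∀ y, (π ⁻¹' {y}).Countable) : IsThin π μ Set.univ := by
  let u := upgradeStandardBorel Z
  obtain ⟨t, ht, hcont, hpol⟩ := hπ.exists_continuous
  have hbor : @BorelSpace Z t _ := ⟨by
    rw [borel_eq_borel_of_le (t' := u.toTopologicalSpace) hpol inferInstance ht]
    exact u.toBorelSpace.measurable_eq⟩
  exact @isThin_univ_of_continuous Z Y t hpol _ hbor _ _ _ _ _ _ _ _ _ hcont hcount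

/-- A Borel relation with countable sections is, over almost every point, covered by the graphs
of countably many measurable functions. -/
theorem exists_measurable_forall_ae_exists_eq {X Y : Type*} [MeasurableSpace X]
    [StandardBorelSpace X] [TopologicalSpace Y] [PolishSpace Y]
    [MeasurableSpace Y] [BorelSpace Y] [Nonempty X] (μ : Measure Y) [IsFiniteMeasure μ]
    [μ.OuterRegular] {Q : X → Y → Prop} (hQ : MeasurableSet {p : X × Y | Q p.1 p.2})
    (hcount : ∀ y, {x | Q x y}.Countable) :
    ∃ f : ℕ → Y → X, (∀ n, Measurable (f n)) ∧ ∀ᵐ y ∂μ, ∀ x, Q x y → ∃ n, f n y = x := by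
  let Z := {p : X × Y // Q p.1 p.2}
  have : StandardBorelSpace Z := hQ.standardBorel
  have hπ : Measurable fun z : Z => z.1.2 := measurable_snd.comp measurable_subtype_coe
  obtain ⟨S, hS, hinj, N, hN, hc⟩ := isThin_univ (μ := μ) hπ fun y => by
    have : (fun z : Z => z.1.2) ⁻¹' {y} ⊆ (fun z : Z => z.1.1) ⁻¹' {x | Q x y} := by
      rintro ⟨⟨x, y'⟩, h⟩ (rfl : y' = y)
      exact h
    refine Set.MapsTo.countable_of_injOn (f := fun z : Z => z.1.1) this ?_ (hcount y)
    rintro ⟨⟨x, y⟩, h⟩ (rfl : y = _) ⟨⟨x', y'⟩, h'⟩ (rfl : y' = _) (rfl : x = x')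
    rfl
  have hf : ∀ i, ∃ f : Y → X, Measurable f ∧ ∀ z ∈ S i, f z.1.2 = z.1.1 := by
    intro i
    have := (hS i).standardBorel
    -- By Lusin–Souslin, `S i` is the graph of a measurable function on a Borel set, which extends
    -- to all of `Y`.
    have hemb : MeasurableEmbedding ((S i).domRestrict fun z : Z => z.1.2) :=
      (hπ.comp measurable_subtype_coe).measurableEmbedding (Set.injOn_iff_injective.1 (hinj i))
    obtain ⟨f, hf, hfe⟩ := hemb.exists_measurable_extend (g := fun z : S i => z.1.1.1)
      (measurable_fst.comp (measurable_subtype_coe.comp measurable_subtype_coe))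
      fun _ => inferInstance
    exact ⟨f, hf, fun z hz => congrFun hfe ⟨z, hz⟩⟩
  choose f hf hfe using hf
  refine ⟨f, hf, ?_⟩
  filter_upwards [compl_mem_ae_iff.2 hN] with y hy x hxy
  rcases hc (Set.mem_univ (⟨(x, y), hxy⟩ : Z)) with h | h
  · exact absurd h hy
  · obtain ⟨i, hi⟩ := Set.mem_iUnion.1 h
    exact ⟨i, hfe i _ hi⟩

end MeasureTheory

/-! ### Walsh functions and simultaneous halving -/

namespace CantorSpace

open MeasureTheory

/-- The Walsh function attached to a finite set of coordinates. -/
noncomputable def walsh (F : Finset ℕ) (x : ℕ → Bool) : ℝ := ∏ i ∈ F, if x i then -1 else 1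

theorem measurable_walsh (F : Finset ℕ) : Measurable (walsh F) :=
  Finset.measurable_fun_prod F fun i _ =>
    (measurable_from_top (f := fun b : Bool => if b then (-1 : ℝ) else 1)).comp
      (measurable_pi_apply i)

theorem walsh_eq_one_or (F : Finset ℕ) (x : ℕ → Bool) : walsh F x = 1 ∨ walsh F x = -1 := by
  induction F using Finset.induction_on with
  | empty => simp [walsh]
  | insert i F hi ih =>
    have : walsh (insert i F) x = (if x i then -1 else 1) * walsh F x := Finset.prod_insert hi
    rw [this]
    rcases ih with h | h <;> cases x i <;> simp [h]

theorem integrable_walsh (F : Finset ℕ) (ν : Measure (ℕ → Bool)) [IsFiniteMeasure ν] :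
    Integrable (walsh F) ν := by
  refine .of_bound (measurable_walsh F).aestronglyMeasurable 1 (.of_forall fun x => ?_)
  rcases walsh_eq_one_or F x with h | h <;> simp [h]

/-- The pairs of sequences which agree below `M`. -/
def agree (M : ℕ) : Set ((ℕ → Bool) × (ℕ → Bool)) := {p | ∀ i < M, p.1 i = p.2 i}

theorem measurableSet_agree (M : ℕ) : MeasurableSet (agree M) := by
  have : agree M = ⋂ i, ⋂ (_ : i < M), {p | p.1 i = p.2 i} := by ext; simp [agree]
  rw [this]
  exact .iInter fun i => .iInter fun _ => measurableSet_eq_fun (by fun_prop) (by fun_prop)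

/-- The sum factors as a product over `i < M` whose factors are 2 where the bits agree and 0 where
they differ. -/
theorem sum_walsh_mul_walsh (M : ℕ) (p : (ℕ → Bool) × (ℕ → Bool)) :
    ∑ F ∈ (Finset.range M).powerset, walsh F p.1 * walsh F p.2 =
      (agree M).indicator (fun _ => (2 : ℝ) ^ M) p := by
  simp_rw [walsh, ← Finset.prod_mul_distrib]
  rw [← Finset.prod_one_add]
  by_cases h : p ∈ agree M
  · rw [Set.indicator_of_mem h, Finset.prod_congr rfl (g := fun _ => (2 : ℝ)), Finset.prod_const,
      Finset.card_range]
    intro i hi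
    rw [h i (Finset.mem_range.1 hi)]
    cases p.2 i <;> norm_num
  · rw [Set.indicator_of_notMem h]
    simp only [agree, Set.mem_ofPred_eq, not_forall] at h
    obtain ⟨i, hi, hne⟩ := h
    refine Finset.prod_eq_zero (Finset.mem_range.2 hi) ?_
    revert hne
    cases p.1 i <;> cases p.2 i <;> simp

/-- Parseval's identity for Walsh functions. -/
theorem sum_integral_walsh_sq (ν : Measure (ℕ → Bool)) [IsFiniteMeasure ν] (M : ℕ) :
    ∑ F ∈ (Finset.range M).powerset, (∫ x, walsh F x ∂ν) ^ 2 =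
      2 ^ M * (ν.prod ν).real (agree M) := by
  simp_rw [sq, ← integral_prod_mul]
  rw [← integral_finsetSum]
  · simp_rw [sum_walsh_mul_walsh]
    rw [integral_indicator_const _ (measurableSet_agree M), smul_eq_mul, mul_comm]
  · exact fun F _ => (integrable_walsh F ν).mul_prod (integrable_walsh F ν)

/-- The sets decrease to the diagonal, which is null by Fubini since `ν` has no atoms. -/
theorem tendsto_measure_agree (ν : Measure (ℕ → Bool)) [IsFiniteMeasure ν] [NullSingletonClass ν] :
    Tendsto (fun M => (ν.prod ν).real (agree M)) atTop (𝓝 0) := by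
  have hanti : Antitone agree := fun M N h p hp i hi => hp i (hi.trans_le h)
  have h := tendsto_measure_iInter_atTop (μ := ν.prod ν)
    (fun M => (measurableSet_agree M).nullMeasurableSet) hanti ⟨0, measure_ne_top _ _⟩
  have h0 : (ν.prod ν) (⋂ M, agree M) = 0 := by
    rw [Measure.measure_prod_null (.iInter measurableSet_agree)]
    refine .of_forall fun x => ?_
    refine measure_mono_null (t := {x}) (fun y hy => ?_) (measure_singleton x)
    exact funext fun i => ((Set.mem_iInter.1 hy (i + 1)) i i.lt_succ_self).symm
  rw [h0] at h
  exact (ENNReal.tendsto_toReal ENNReal.zero_ne_top).comp h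

theorem integral_walsh (F : Finset ℕ) (ν : Measure (ℕ → Bool)) [IsFiniteMeasure ν] :
    ∫ x, walsh F x ∂ν = ν.real {x | walsh F x = 1} - ν.real {x | walsh F x = 1}ᶜ := by
  have hS : MeasurableSet {x | walsh F x = 1} := measurable_walsh F (measurableSet_singleton 1)
  rw [← integral_add_compl hS (integrable_walsh F ν),
    setIntegral_congr_fun hS (g := fun _ => (1 : ℝ)) fun x hx => hx,
    setIntegral_congr_fun hS.compl (g := fun _ => (-1 : ℝ)) fun x hx =>
      (walsh_eq_one_or F x).resolve_left hx]
  simp [sub_eq_add_neg]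

/-- Finitely many measures without atoms can be almost halved by a single set. -/
theorem exists_almost_halving {ι : Type*} [Fintype ι] (ν : ι → Measure (ℕ → Bool))
    [∀ j, IsFiniteMeasure (ν j)] [∀ j, NullSingletonClass (ν j)] {η : ℝ} (hη : 0 < η) :
    ∃ S, MeasurableSet S ∧ ∀ j, |(ν j).real S - (ν j).real Sᶜ| < η := by
  have hlim : Tendsto (fun M => ∑ j, ((ν j).prod (ν j)).real (agree M)) atTop (𝓝 0) := by
    simpa using tendsto_finsetSum Finset.univ fun j _ => tendsto_measure_agree (ν j)
  -- By Parseval this sum is the average over the `2 ^ M` sets `F` of `∑ j, (∫ walsh F) ^ 2`, so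
  -- some `F` stays below `η ^ 2`.
  obtain ⟨M, hM⟩ := (hlim.eventually_lt_const (pow_pos hη 2)).exists
  have hlt : ∑ F ∈ (Finset.range M).powerset, ∑ j, (∫ x, walsh F x ∂ν j) ^ 2 <
      ∑ F ∈ (Finset.range M).powerset, η ^ 2 := by
    rw [Finset.sum_comm]
    simp_rw [sum_integral_walsh_sq]
    rw [← Finset.mul_sum, Finset.sum_const, Finset.card_powerset, Finset.card_range,
      nsmul_eq_mul]
    push_cast
    gcongr
  obtain ⟨F, -, hF⟩ := Finset.exists_lt_of_sum_lt hlt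
  refine ⟨{x | walsh F x = 1}, measurable_walsh F (measurableSet_singleton 1), fun j => ?_⟩
  rw [← integral_walsh]
  refine abs_lt_of_sq_lt_sq (lt_of_le_of_lt ?_ hF) hη.le
  exact Finset.single_le_sum (f := fun j => (∫ x, walsh F x ∂ν j) ^ 2)
    (fun j _ => sq_nonneg _) (Finset.mem_univ j)

end CantorSpace

/-! ### Meeting one requirement -/

namespace CantorSpace

open MeasureTheory

/-- The initial segment of length `L` of a sequence. -/
def initSeg (L : ℕ) (x : ℕ → Bool) : Fin L → Bool := fun i => x i

theorem measurable_initSeg (L : ℕ) : Measurable (initSeg L) :=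
  measurable_pi_lambda _ fun _ => measurable_pi_apply _

/-- Concentrating a measure on a set which meets every piece of a finite partition in a
substantial proportion, without changing the measure of the pieces. -/
theorem exists_measure_concentrated {X T : Type*} [MeasurableSpace X] [Fintype T]
    [MeasurableSpace T] [MeasurableSingletonClass T] (m : Measure X) [IsFiniteMeasure m]
    {p : X → T} (hp : Measurable p) {C : Set X} (hC : MeasurableSet C) {K : ℝ≥0∞}
    (hK : ∀ t, m (p ⁻¹' {t}) ≤ K * m (C ∩ p ⁻¹' {t})) :
    ∃ m' : Measure X, (∀ A, MeasurableSet A → m' A ≤ K * m A) ∧ m' Cᶜ = 0 ∧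
      m'.map p = m.map p := by
  -- The density restoring the mass of each piece. If `C` misses almost all of a piece, `hK` makes
  -- the piece null.
  let c : T → ℝ≥0∞ := fun t => m (p ⁻¹' {t}) / m (C ∩ p ⁻¹' {t})
  have hcK : ∀ t, c t ≤ K := fun t => ENNReal.div_le_of_le_mul (hK t)
  refine ⟨(m.restrict C).withDensity fun x => c (p x), fun A hA => ?_, ?_, ?_⟩
  · rw [withDensity_apply _ hA]
    calc ∫⁻ x in A, c (p x) ∂m.restrict C ≤ ∫⁻ _ in A, K ∂m.restrict C :=
          lintegral_mono fun x => hcK _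
      _ = K * m.restrict C A := by rw [setLIntegral_const]
      _ ≤ K * m A := by gcongr; exact Measure.restrict_le_self
  · refine withDensity_absolutelyContinuous _ _ ?_
    rw [Measure.restrict_apply hC.compl, Set.compl_inter_self, measure_empty]
  · refine Measure.ext_of_singleton fun t => ?_
    have ht := hp (measurableSet_singleton t)
    rw [Measure.map_apply hp (measurableSet_singleton t),
      Measure.map_apply hp (measurableSet_singleton t), withDensity_apply _ ht,
      setLIntegral_congr_fun ht (g := fun _ => c t) fun x hx => by
        rw [show p x = t from hx],
      setLIntegral_const, Measure.restrict_apply ht, Set.inter_comm]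
    rcases eq_or_ne (m (C ∩ p ⁻¹' {t})) 0 with h | h
    · have := hK t
      rw [h, mul_zero] at this
      rw [h, mul_zero, le_antisymm this zero_le]
    · exact ENNReal.div_mul_cancel h (measure_ne_top _ _)

/-- Given a measurable function `f` and a coordinate `n`, a substantial part of each cylinder can
be kept so that no kept point with `n`-th bit `b` is the image of one with the opposite bit. -/
theorem exists_measurableSet_avoiding (m : Measure (ℕ → Bool)) [IsFiniteMeasure m]
    [NullSingletonClass m] {f : (ℕ → Bool) → ℕ → Bool} (hf : Measurable f) {n L : ℕ} (hn : n < L)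
    (b : Bool) {η : ℝ} (hη : 0 < η) :
    ∃ E, MeasurableSet E ∧
      (∀ t, m.real (initSeg L ⁻¹' {t}) / 2 - η ≤ m.real (E ∩ initSeg L ⁻¹' {t})) ∧
      ∀ x ∈ E, ∀ y ∈ E, x n = b → y n ≠ b → f y ≠ x := by
  -- The atoms of the image measure cannot be halved. They are countably many, so a small open `U`
  -- covers them.
  let A : Set (ℕ → Bool) := {a | 0 < m (f ⁻¹' {a})}
  have hA : A.Countable := Measure.countable_meas_pos_of_disjoint_iUnion
    (fun a => hf (measurableSet_singleton a))
    fun a a' h => (Set.disjoint_singleton.2 h).preimage f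
  obtain ⟨U, hAU, hU, hmU⟩ := Set.exists_isOpen_lt_of_lt A (ENNReal.ofReal (η / 2)) (μ := m) (by
    rw [hA.measure_zero]; positivity)
  have hmU' : m.real U ≤ η / 2 :=
    ENNReal.toReal_le_of_le_ofReal (by positivity) hmU.le
  have hcyl : ∀ t, MeasurableSet (initSeg L ⁻¹' {t}) := fun t =>
    measurable_initSeg L (measurableSet_singleton t)
  have hfA : MeasurableSet (f ⁻¹' A) := hf hA.measurableSet
  let ν : (Fin L → Bool) ⊕ (Fin L → Bool) → Measure (ℕ → Bool) :=
    Sum.elim (fun t => m.restrict (initSeg L ⁻¹' {t}))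
      fun t => (m.restrict (initSeg L ⁻¹' {t} \ f ⁻¹' A)).map f
  have hfin : ∀ j, IsFiniteMeasure (ν j) := by
    rintro (t | t) <;> dsimp only [ν, Sum.elim_inl, Sum.elim_inr] <;> infer_instance
  have hnull : ∀ j, NullSingletonClass (ν j) := by
    rintro (t | t)
    · dsimp only [ν, Sum.elim_inl]
      infer_instance
    · refine ⟨fun a => ?_⟩
      dsimp only [ν, Sum.elim_inr]
      rw [Measure.map_apply hf (measurableSet_singleton a),
        Measure.restrict_apply (hf (measurableSet_singleton a))]
      by_cases ha : a ∈ A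
      · convert measure_empty (μ := m)
        ext x
        simp only [Set.mem_inter_iff, Set.mem_preimage, Set.mem_singleton_iff, Set.mem_sdiff,
          Set.mem_empty_iff_false, iff_false]
        rintro ⟨rfl, -, h⟩
        exact h ha
      · exact measure_mono_null Set.inter_subset_left (nonpos_iff_eq_zero.1 (not_lt.1 ha))
  obtain ⟨S, hS, hνS⟩ := exists_almost_halving ν (half_pos hη)
  have hbit : MeasurableSet {x : ℕ → Bool | x n = b} :=
    (measurable_pi_apply n : Measurable fun x : ℕ → Bool => x n) (measurableSet_singleton b)
  -- A kept `y` has `f y` in `A ⊆ U` or outside `S`, so never in `S \ U`. Halving up to `η / 2`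
  -- loses `η / 4`, and `U` at most `η / 2`.
  refine ⟨({x | x n = b} ∩ (S \ U)) ∪ ({x | x n = b}ᶜ ∩ f ⁻¹' (A ∪ Sᶜ)),
    (hbit.inter (hS.diff hU.measurableSet)).union
      (hbit.compl.inter (hf (hA.measurableSet.union hS.compl))), fun t => ?_, ?_⟩
  · have htn : ∀ x ∈ initSeg L ⁻¹' {t}, x n = t ⟨n, hn⟩ := fun x hx => by
      rw [← show initSeg L x = t from hx]; rfl
    by_cases htb : t ⟨n, hn⟩ = b
    · have h := abs_lt.1 (hνS (.inl t))
      have htot := measureReal_add_measureReal_compl (μ := ν (.inl t)) hS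
      dsimp only [ν, Sum.elim_inl] at h htot
      rw [measureReal_restrict_apply MeasurableSet.univ, Set.univ_inter] at htot
      rw [measureReal_restrict_apply hS] at h htot
      have hle : m.real (S ∩ initSeg L ⁻¹' {t}) ≤ m.real ((({x | x n = b} ∩ (S \ U)) ∪
          ({x | x n = b}ᶜ ∩ f ⁻¹' (A ∪ Sᶜ))) ∩ initSeg L ⁻¹' {t}) + m.real U := by
        refine (measureReal_mono fun x hx => ?_).trans (measureReal_union_le _ _)
        by_cases hxU : x ∈ U
        · exact Or.inr hxU
        · exact Or.inl ⟨Or.inl ⟨(htn x hx.2).trans htb, hx.1, hxU⟩, hx.2⟩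
      linarith [h.1]
    · have h := abs_lt.1 (hνS (.inr t))
      have htot := measureReal_add_measureReal_compl (μ := ν (.inr t)) hS
      dsimp only [ν, Sum.elim_inr] at h htot
      rw [map_measureReal_apply hf MeasurableSet.univ, Set.preimage_univ,
        measureReal_restrict_apply MeasurableSet.univ, Set.univ_inter] at htot
      rw [map_measureReal_apply hf hS, map_measureReal_apply hf hS.compl,
        measureReal_restrict_apply (hf hS.compl)] at h htot
      have hsplit := measureReal_inter_add_sdiff (μ := m) (s := initSeg L ⁻¹' {t}) hfA
      have hle : m.real (initSeg L ⁻¹' {t} ∩ f ⁻¹' A) +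
          m.real (f ⁻¹' Sᶜ ∩ (initSeg L ⁻¹' {t} \ f ⁻¹' A)) ≤
          m.real ((({x | x n = b} ∩ (S \ U)) ∪
            ({x | x n = b}ᶜ ∩ f ⁻¹' (A ∪ Sᶜ))) ∩ initSeg L ⁻¹' {t}) := by
        rw [← measureReal_union (Set.disjoint_left.2 fun x hx hx' => hx'.2.2 hx.2)
          ((hf hS.compl).inter ((hcyl t).diff hfA))]
        refine measureReal_mono ?_
        rintro x (⟨hx, hxA⟩ | ⟨hxS, hx, -⟩)
        · exact ⟨Or.inr ⟨fun h => htb ((htn x hx).symm.trans h), Or.inl hxA⟩, hx⟩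
        · exact ⟨Or.inr ⟨fun h => htb ((htn x hx).symm.trans h), Or.inr hxS⟩, hx⟩
      have h0 : 0 ≤ m.real (initSeg L ⁻¹' {t} ∩ f ⁻¹' A) := measureReal_nonneg
      linarith [h.2]
  · rintro x (⟨-, hxS, hxU⟩ | ⟨hxb, -⟩) y (⟨hyb, -⟩ | ⟨-, hy⟩) hx hy' rfl
    · exact hy' hyb
    · rcases hy with h | h
      · exact hxU (hAU h)
      · exact h hxS
    · exact hxb hx
    · exact hxb hx

/-- Makes an additive error proportionate to every non-null cylinder. -/
theorem exists_pos_forall_eq_zero_or_le {T : Type*} [Finite T] (u : T → ℝ) (hu : ∀ t, 0 ≤ u t) :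
    ∃ η > 0, ∀ t, u t = 0 ∨ η ≤ u t := by
  have h : ∀ᶠ η in 𝓝[>] (0 : ℝ), ∀ t, u t = 0 ∨ η ≤ u t := by
    rw [eventually_all]
    intro t
    rcases (hu t).eq_or_lt with h | h
    · exact .of_forall fun _ => Or.inl h.symm
    · filter_upwards [Ioo_mem_nhdsGT h] with η hη using Or.inr hη.2.le
  obtain ⟨η, h1, h2⟩ := (h.and self_mem_nhdsWithin).exists
  exact ⟨η, h2, h1⟩

/-- The fusion step. -/
theorem exists_isClosed_measure_avoiding (m : Measure (ℕ → Bool)) [IsFiniteMeasure m]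
    [NullSingletonClass m] {C : Set (ℕ → Bool)} (hC : IsClosed C) (hmC : m Cᶜ = 0)
    {f : (ℕ → Bool) → ℕ → Bool} (hf : Measurable f) {n L : ℕ} (hn : n < L) (b : Bool) :
    ∃ C' ⊆ C, IsClosed C' ∧ (∀ x ∈ C', ∀ y ∈ C', x n = b → y n ≠ b → f y ≠ x) ∧
      ∃ m' : Measure (ℕ → Bool), (∀ A, MeasurableSet A → m' A ≤ 4 * m A) ∧ m' C'ᶜ = 0 ∧
        m'.map (initSeg L) = m.map (initSeg L) := by
  obtain ⟨η, hη, hηt⟩ := exists_pos_forall_eq_zero_or_le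
    (fun t => m.real (initSeg L ⁻¹' {t})) fun t => measureReal_nonneg
  -- Two losses of `η / 8`, here and in the closed approximation, leave at least `1/2 - 1/4` of each
  -- cylinder: hence the factor 4.
  obtain ⟨E, hE, hEt, hav⟩ :=
    exists_measurableSet_avoiding m hf hn b (show (0 : ℝ) < η / 8 by positivity)
  have hEC : MeasurableSet (E ∩ C) := hE.inter hC.measurableSet
  obtain ⟨C', hC'E, hC', hlt⟩ := hEC.exists_isClosed_sdiff_lt (measure_ne_top m _)
    (ε := ENNReal.ofReal (η / 8)) (by positivity)
  refine ⟨C', hC'E.trans Set.inter_subset_right, hC', fun x hx y hy =>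
    hav x (hC'E hx).1 y (hC'E hy).1, exists_measure_concentrated m (measurable_initSeg L)
      hC'.measurableSet fun t => ?_⟩
  have hle : m.real (E ∩ initSeg L ⁻¹' {t}) ≤
      m.real (C' ∩ initSeg L ⁻¹' {t}) + η / 8 := by
    have h1 : m.real (E ∩ initSeg L ⁻¹' {t}) ≤ m.real (C' ∩ initSeg L ⁻¹' {t}) +
        m.real ((E ∩ C) \ C') + m.real Cᶜ := by
      refine (measureReal_mono fun x hx => ?_).trans ((measureReal_union_le
        ((C' ∩ initSeg L ⁻¹' {t}) ∪ ((E ∩ C) \ C')) Cᶜ).trans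
          (add_le_add_left (measureReal_union_le _ _) _))
      by_cases hxC : x ∈ C
      · by_cases hxC' : x ∈ C'
        · exact Or.inl (Or.inl ⟨hxC', hx.2⟩)
        · exact Or.inl (Or.inr ⟨⟨hx.1, hxC⟩, hxC'⟩)
      · exact Or.inr hxC
    have h2 : m.real Cᶜ = 0 := by simp [Measure.real, hmC]
    have h3 : m.real ((E ∩ C) \ C') ≤ η / 8 :=
      ENNReal.toReal_le_of_le_ofReal (by positivity) hlt.le
    linarith
  have key : m.real (initSeg L ⁻¹' {t}) ≤ 4 * m.real (C' ∩ initSeg L ⁻¹' {t}) := by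
    rcases hηt t with h | h
    · rw [h]
      positivity
    · linarith [hEt t]
  rw [← ENNReal.ofReal_toReal (measure_ne_top m (initSeg L ⁻¹' {t})),
    ← ENNReal.ofReal_toReal (measure_ne_top m (C' ∩ initSeg L ⁻¹' {t})),
    ← ENNReal.ofReal_ofNat, ← ENNReal.ofReal_mul (by norm_num)]
  exact ENNReal.ofReal_le_ofReal key

end CantorSpace

/-! ### Mass distribution and the fusion -/

namespace CantorSpace

open MeasureTheory

/-- The fair coin measure on the Cantor space. -/
noncomputable def fairCoin : Measure (ℕ → Bool) :=
  Measure.infinitePi fun _ => (PMF.uniformOfFintype Bool).toMeasure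

instance : IsProbabilityMeasure fairCoin := by unfold fairCoin; infer_instance

theorem fairCoin_initSeg (n : ℕ) (t : Fin n → Bool) :
    fairCoin (initSeg n ⁻¹' {t}) = 2⁻¹ ^ n := by
  let u : ℕ → Set Bool := fun i => if h : i < n then {t ⟨i, h⟩} else Set.univ
  have h : initSeg n ⁻¹' {t} = (Finset.range n : Set ℕ).pi u := by
    ext x
    simp only [Set.mem_preimage, Set.mem_singleton_iff, funext_iff, Set.mem_pi, Finset.coe_range,
      Set.mem_Iio, initSeg]
    constructor
    · intro hx i hi
      simpa [u, hi] using hx ⟨i, hi⟩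
    · intro hx i
      simpa [u] using hx i i.2
  rw [h, fairCoin, Measure.infinitePi_pi _ fun i _ => .of_discrete,
    Finset.prod_congr rfl (g := fun _ => (2⁻¹ : ℝ≥0∞)), Finset.prod_const, Finset.card_range]
  intro i hi
  simp [u, Finset.mem_range.1 hi]

/-- The pairs maintained by the fusion: a probability measure concentrated on a closed set,
with at most a constant multiple of the fair coin measure on each cylinder and, on cylinders of
length at least `N`, with at most the measure that `g` prescribes. -/
structure IsAdmissible (g : ℝ≥0 → ℝ≥0) (N : ℕ) (C : Set (ℕ → Bool)) (m : Measure (ℕ → Bool)) :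
    Prop where
  isClosed : IsClosed C
  measure_univ : m Set.univ = 1
  measure_compl : m Cᶜ = 0
  exists_le : ∃ D : ℝ≥0, ∀ n t, m (initSeg n ⁻¹' {t}) ≤ D * 2⁻¹ ^ n
  le_gauge : ∀ n t, N ≤ n → m (initSeg n ⁻¹' {t}) ≤ g (2⁻¹ ^ n)

theorem IsAdmissible.nullSingletonClass {g : ℝ≥0 → ℝ≥0} {N : ℕ} {C : Set (ℕ → Bool)}
    {m : Measure (ℕ → Bool)} (h : IsAdmissible g N C m) : NullSingletonClass m := by
  obtain ⟨D, hD⟩ := h.exists_le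
  refine ⟨fun x => nonpos_iff_eq_zero.1 ?_⟩
  have hlim : Tendsto (fun n : ℕ => (D : ℝ≥0∞) * 2⁻¹ ^ n) atTop (𝓝 0) := by
    simpa using ENNReal.Tendsto.const_mul
      (ENNReal.tendsto_pow_atTop_nhds_zero_of_lt_one (r := 2⁻¹) (by simp)) (a := (D : ℝ≥0∞))
      (Or.inr ENNReal.coe_ne_top)
  refine ge_of_tendsto' hlim fun n => (measure_mono ?_).trans (hD n (initSeg n x))
  simp

/-- The only place where `g ≺ id` enters: `g` eventually absorbs any constant. -/
theorem exists_forall_mul_le_gauge {g : ℝ≥0 → ℝ≥0} (hg : IsGauge g) (hgid : GaugePrec g id)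
    (K : ℝ≥0) : ∃ L, ∀ k ≥ L, K * 2⁻¹ ^ k ≤ g (2⁻¹ ^ k) := by
  have hlim : Tendsto (fun k : ℕ => (2⁻¹ : ℝ≥0) ^ k) atTop (𝓝[>] 0) :=
    tendsto_nhdsWithin_iff.2 ⟨NNReal.tendsto_pow_atTop_nhds_zero_of_lt_one
      (inv_lt_one_of_one_lt₀ one_lt_two), .of_forall fun k => by simp⟩
  have h := (hgid.comp hlim).eventually_lt_const (show 0 < (K + 1)⁻¹ by positivity)
  obtain ⟨L, hL⟩ := eventually_atTop.1 h
  refine ⟨L, fun k hk => ?_⟩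
  have hpos : 0 < g (2⁻¹ ^ k) := hg.pos _ (by positivity)
  have h1 : (2⁻¹ : ℝ≥0) ^ k / g (2⁻¹ ^ k) < (K + 1)⁻¹ := hL k hk
  rw [div_lt_iff₀ hpos, ← div_eq_inv_mul, lt_div_iff₀ (by positivity), mul_comm] at h1
  exact le_trans (by gcongr; exact le_self_add) h1.le

theorem measure_initSeg_eq_of_map_eq {m m' : Measure (ℕ → Bool)} {n L : ℕ} (h : n ≤ L)
    (hm : m'.map (initSeg L) = m.map (initSeg L)) (t : Fin n → Bool) :
    m' (initSeg n ⁻¹' {t}) = m (initSeg n ⁻¹' {t}) := by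
  have hpre : initSeg n ⁻¹' {t} =
      initSeg L ⁻¹' {s | (fun i : Fin n => s (Fin.castLE h i)) = t} := by
    ext x
    rfl
  rw [hpre, ← Measure.map_apply (measurable_initSeg L) .of_discrete, hm,
    Measure.map_apply (measurable_initSeg L) .of_discrete]

/-- The constant `D` worsens to `4 * D` but `N` survives: lengths up to `L` keep their measure, and
beyond `L` the gauge dominates `4 * D * 2⁻¹ ^ k`. -/
theorem IsAdmissible.exists_avoiding {g : ℝ≥0 → ℝ≥0} (hg : IsGauge g) (hgid : GaugePrec g id)
    {N : ℕ} {C : Set (ℕ → Bool)} {m : Measure (ℕ → Bool)} (h : IsAdmissible g N C m)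
    {f : (ℕ → Bool) → ℕ → Bool} (hf : Measurable f) (n : ℕ) (b : Bool) :
    ∃ C' m', IsAdmissible g N C' m' ∧ C' ⊆ C ∧
      ∀ x ∈ C', ∀ y ∈ C', x n = b → y n ≠ b → f y ≠ x := by
  have := h.nullSingletonClass
  have : IsFiniteMeasure m := ⟨by simp [h.measure_univ]⟩
  obtain ⟨D, hD⟩ := h.exists_le
  obtain ⟨L, hL⟩ := exists_forall_mul_le_gauge hg hgid (4 * D)
  obtain ⟨C', hC'C, hC', hav, m', hm'm, hm'C, hmap⟩ := exists_isClosed_measure_avoiding m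
    h.isClosed h.measure_compl hf (Nat.lt_succ_of_le (le_max_left n L)) b
  have hD' : ∀ k t, m' (initSeg k ⁻¹' {t}) ≤ (4 * D : ℝ≥0) * 2⁻¹ ^ k := by
    intro k t
    refine (hm'm _ (measurable_initSeg k (measurableSet_singleton t))).trans ?_
    push_cast
    rw [mul_assoc]
    gcongr
    exact hD k t
  refine ⟨C', m', ⟨hC', ?_, hm'C, ⟨4 * D, hD'⟩, fun k t hk => ?_⟩, hC'C, hav⟩
  · have h0 := measure_initSeg_eq_of_map_eq (Nat.zero_le _) hmap Fin.elim0
    have huniv : initSeg 0 ⁻¹' {Fin.elim0} = Set.univ :=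
      Set.eq_univ_of_forall fun x => Subsingleton.elim (α := Fin 0 → Bool) _ _
    rw [huniv, h.measure_univ] at h0
    exact h0
  · rcases le_total k L with hkL | hkL
    · rw [measure_initSeg_eq_of_map_eq (hkL.trans ((le_max_right n L).trans (Nat.le_succ _))) hmap]
      exact h.le_gauge k t hk
    · refine (hD' k t).trans ?_
      have := ENNReal.coe_le_coe.2 (hL k hkL)
      push_cast at this ⊢
      exact this

/-- The sets of small diameter have at most the measure that the gauge function allows. -/
theorem IsAdmissible.measure_le_gauge_ediam {g : ℝ≥0 → ℝ≥0} (hg : Monotone g) {N : ℕ}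
    {C : Set (ℕ → Bool)} {m : Measure (ℕ → Bool)} (h : IsAdmissible g N C m)
    {U : Set (ℕ → Bool)} (hU : Metric.ediam U < (2⁻¹ ^ N : ℝ≥0)) :
    m U ≤ g (Metric.ediam U).toNNReal := by
  have := h.nullSingletonClass
  rcases U.subsingleton_or_nontrivial with hs | ⟨x, hx, y, hy, hxy⟩
  · simp [hs.measure_zero m]
  classical
  have hex : ∃ n, ∃ x ∈ U, ∃ y ∈ U, x n ≠ y n := by
    obtain ⟨n, hn⟩ := Function.ne_iff.1 hxy
    exact ⟨n, x, hx, y, hy, hn⟩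
  obtain ⟨u, hu, v, hv, huv⟩ := Nat.find_spec hex
  have hagree : ∀ i < Nat.find hex, ∀ x ∈ U, ∀ y ∈ U, x i = y i := by
    intro i hi x hx y hy
    by_contra hne
    exact Nat.find_min hex hi ⟨x, hx, y, hy, hne⟩
  set n := Nat.find hex
  have hle : ((2⁻¹ ^ n : ℝ≥0) : ℝ≥0∞) ≤ Metric.ediam U := by
    refine le_trans (le_of_eq ?_) (Metric.edist_le_ediam_of_mem hu hv)
    rw [edist_nndist, ENNReal.coe_inj]
    refine NNReal.coe_injective ?_
    rw [coe_nndist, cantor_dist_eq huv fun i hi => hagree i hi u hu v hv]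
    simp
  have hNn : N ≤ n := by
    have := ENNReal.coe_lt_coe.1 (hle.trans_lt hU)
    exact ((pow_lt_pow_iff_right_of_lt_one₀ (by simp) (inv_lt_one_of_one_lt₀ one_lt_two)).1 this).le
  calc m U ≤ m (initSeg n ⁻¹' {initSeg n u}) :=
        measure_mono fun x hx => funext fun i => hagree i i.2 x hx u hu
    _ ≤ g (2⁻¹ ^ n) := h.le_gauge n _ hNn
    _ ≤ g (Metric.ediam U).toNNReal :=
        ENNReal.coe_le_coe.2 (hg (ENNReal.le_toNNReal_of_coe_le hle hU.ne_top))

theorem exists_isAdmissible_subset {g : ℝ≥0 → ℝ≥0} (hg : IsGauge g) (hgid : GaugePrec g id)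
    {G : Set (ℕ → Bool)} (hG : G ∈ ae fairCoin) :
    ∃ N C m, IsAdmissible g N C m ∧ C ⊆ G := by
  obtain ⟨N, hN⟩ := exists_forall_mul_le_gauge hg hgid 2
  obtain ⟨G', hG'G, hG', hmeas⟩ : ∃ G' ⊆ G, MeasurableSet G' ∧ fairCoin G' = 1 := by
    refine ⟨(toMeasurable fairCoin Gᶜ)ᶜ, Set.compl_subset_comm.1 (subset_toMeasurable _ _),
      (measurableSet_toMeasurable _ _).compl, ?_⟩
    rw [prob_compl_eq_one_iff (measurableSet_toMeasurable _ _), measure_toMeasurable]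
    exact hG
  obtain ⟨C, hCG, hC, hlt⟩ := hG'.exists_isClosed_lt_add (measure_ne_top fairCoin _)
    (ε := 2⁻¹) (by simp)
  rw [hmeas] at hlt
  have hhalf : 2⁻¹ ≤ fairCoin C := by
    by_contra! h
    exact (hlt.trans_le (add_le_add_left h.le _)).ne (ENNReal.inv_two_add_inv_two).symm
  have h0 : fairCoin C ≠ 0 := fun h => by simp [h] at hhalf
  have hle : ∀ n t, ((fairCoin C)⁻¹ • fairCoin.restrict C) (initSeg n ⁻¹' {t}) ≤
      (2 : ℝ≥0) * 2⁻¹ ^ n := by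
    intro n t
    rw [Measure.smul_apply, smul_eq_mul]
    refine mul_le_mul' ?_ ((Measure.restrict_apply_le _ _).trans (fairCoin_initSeg n t).le)
    exact ENNReal.inv_le_iff_inv_le.1 hhalf
  refine ⟨N, C, (fairCoin C)⁻¹ • fairCoin.restrict C, ⟨hC, ?_, ?_, ⟨2, hle⟩, fun n t hn => ?_⟩,
    hCG.trans hG'G⟩
  · rw [Measure.smul_apply, Measure.restrict_apply_univ, smul_eq_mul]
    exact ENNReal.inv_mul_cancel h0 (measure_ne_top _ _)
  · rw [Measure.smul_apply, Measure.restrict_apply hC.measurableSet.compl, Set.compl_inter_self,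
      measure_empty, smul_zero]
  · refine (hle n t).trans ?_
    have := ENNReal.coe_le_coe.2 (hN n hn)
    push_cast at this ⊢
    exact this

/-- The mass distribution principle for a decreasing sequence of closed sets. -/
theorem gaugeMeasure_iInter_pos {g : ℝ≥0 → ℝ≥0} (hg : Monotone g) {N : ℕ}
    {C : ℕ → Set (ℕ → Bool)} {m : ℕ → Measure (ℕ → Bool)} (h : ∀ s, IsAdmissible g N (C s) (m s))
    (hC : Antitone C) : 0 < gaugeMeasure g (⋂ s, C s) := by
  refine lt_of_lt_of_le zero_lt_one (le_trans ?_
    (le_iSup₂_of_le (2⁻¹ ^ N : ℝ≥0) (by positivity) le_rfl))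
  refine le_iInf fun U => le_iInf fun hU => le_iInf fun hd => le_iInf fun hcov => ?_
  obtain ⟨s, hs⟩ := exists_subset_nhds_of_isCompact hC.directed_ge
    (fun s => (h s).isClosed.isCompact) (U := ⋃ i, U i) fun x hx => (isOpen_iUnion hU).mem_nhds (hcov hx)
  calc 1 = m s Set.univ := (h s).measure_univ.symm
    _ ≤ m s (⋃ i, U i) + m s (C s)ᶜ := by
        refine (measure_mono fun x _ => ?_).trans (measure_union_le _ _)
        by_cases hx : x ∈ C s
        · exact Or.inl (hs hx)
        · exact Or.inr hx
    _ = m s (⋃ i, U i) := by rw [(h s).measure_compl, add_zero]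
    _ ≤ ∑' i, m s (U i) := measure_iUnion_le _
    _ ≤ ∑' i, (g (Metric.ediam (U i)).toNNReal : ℝ≥0∞) :=
        ENNReal.tsum_le_tsum fun i => (h s).measure_le_gauge_ediam hg (hd i)

/-- The fusion: all the requirements given by countably many measurable functions are met. -/
theorem exists_isClosed_avoiding {g : ℝ≥0 → ℝ≥0} (hg : IsGauge g) (hgid : GaugePrec g id)
    {G : Set (ℕ → Bool)} (hG : G ∈ ae fairCoin) {f : ℕ → (ℕ → Bool) → ℕ → Bool}
    (hf : ∀ i, Measurable (f i)) :
    ∃ B ⊆ G, IsClosed B ∧ 0 < gaugeMeasure g B ∧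
      ∀ x ∈ B, ∀ y ∈ B, x ≠ y → ∀ i, f i y ≠ x := by
  obtain ⟨N, C₀, m₀, h₀, hC₀⟩ := exists_isAdmissible_subset hg hgid hG
  obtain ⟨e, he⟩ := exists_surjective_nat (ℕ × ℕ × Bool)
  let A := {p : Set (ℕ → Bool) × Measure (ℕ → Bool) // IsAdmissible g N p.1 p.2}
  have hstep : ∀ (p : A) (r : ℕ × ℕ × Bool), ∃ q : A, q.1.1 ⊆ p.1.1 ∧
      ∀ x ∈ q.1.1, ∀ y ∈ q.1.1, x r.2.1 = r.2.2 → y r.2.1 ≠ r.2.2 → f r.1 y ≠ x := by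
    intro p r
    obtain ⟨C', m', h', hsub, hav⟩ := p.2.exists_avoiding hg hgid (hf r.1) r.2.1 r.2.2
    exact ⟨⟨(C', m'), h'⟩, hsub, hav⟩
  choose next hsub hav using hstep
  let S : ℕ → A := fun s => Nat.rec ⟨(C₀, m₀), h₀⟩ (fun s p => next p (e s)) s
  have hanti : Antitone fun s => (S s).1.1 := antitone_nat_of_succ_le fun s => hsub _ _
  refine ⟨⋂ s, (S s).1.1, (Set.iInter_subset _ 0).trans hC₀,
    isClosed_iInter fun s => (S s).2.isClosed,
    gaugeMeasure_iInter_pos hg.monotone (fun s => (S s).2) hanti, fun x hx y hy hxy i => ?_⟩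
  obtain ⟨n, hn⟩ := Function.ne_iff.1 hxy
  obtain ⟨s, hs⟩ := he (i, n, x n)
  have := hav (S s) (e s) x (Set.mem_iInter.1 hx (s + 1)) y (Set.mem_iInter.1 hy (s + 1))
  rw [hs] at this
  exact this rfl hn.symm

end CantorSpace

theorem theorem3p3 (Q : (ℕ → Bool) → (ℕ → Bool) → Prop)
    (hQ : IsLocallyCountableBorelQuasiOrder Q) (g : ℝ≥0 → ℝ≥0) (hg : IsGauge g)
    (hgid : GaugePrec g id) :
    ∃ B : Set (ℕ → Bool), IsClosed B ∧ IsAntichain Q B ∧ 0 < gaugeMeasure g B := by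
  have hmeas : MeasurableSet {p : (ℕ → Bool) × (ℕ → Bool) | Q p.1 p.2} := by
    have := hQ.borel
    rwa [← BorelSpace.measurable_eq] at this
  obtain ⟨f, hf, hfQ⟩ := MeasureTheory.exists_measurable_forall_ae_exists_eq CantorSpace.fairCoin
    hmeas hQ.locally_countable
  obtain ⟨B, hBG, hB, hpos, hav⟩ := CantorSpace.exists_isClosed_avoiding hg hgid hfQ hf
  refine ⟨B, hB, fun x hx y hy hxy hxQy => ?_, hpos⟩
  obtain ⟨i, hi⟩ := hBG hy x hxQy
  exact hav x hx y hy hxy i hi
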